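/- Write $nm$ for the value (if defined) of the $n$-th partial recursive function at $m$. A PER is a symmetric and transitive relation $R$ on $\mathbb N$, with $\mathrm{dom}\,R=\{n\mid (n,n)\in R\}$. A morphism $R\to S$ is a function $f:\mathrm{dom}\,R/R\to\mathrm{dom}\,S/S$ that is tracked by some partial recursive $\phi$: for all $n\in\mathrm{dom}\,R$, $\phi n$ is defined and $f[n]_R=[\phi n]_S$; if $\phi$ is the $x$-th partial recursive function, $x$ is called an index of $f$. This gives the category $\mathcal P$ of PERs. $[R\to S]$ is the PER of indices of morphisms $R\to S$, where two indices are related when they track the same morphism. Let $B\subseteq\mathbb N$ and, for $n\in\mathbb N$, let $W^B_n=\{b\in B\mid nb\text{ is defined}\}$. A PER $R$ is extensional over $B$ if $(n,m)\in R$ implies $W^B_n=W^B_m$, and $n\in\mathrm{dom}\,R$, $W^B_n=W^B_m$ imply $(n,m)\in R$. It is complete over $B$ if for every recursive sequence $(s_k)$ in $\mathrm{dom}\,R$ with $W^B_{s_k}\subseteq W^B_{s_{k+1}}$ for all $k$, every $n$ with $W^B_n=\bigcup_k W^B_{s_k}$ is in $\mathrm{dom}\,R$. A pointed CEPER (pointed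 complete extensional PER) is a PER that is extensional and complete over some $B\subseteq\mathbb N$ and whose domain contains the indices of the nowhere defined function; their class is its least element. $\mathcal C$ is the category of pointed CEPERs and those morphisms of PERs that preserve the least element. An endofunctor $F$ of $\mathcal P$ (or of $\mathcal C$) is realizable if there is a single partial recursive function $\phi$ that tracks it: for all objects $R,S$, all morphisms $f:R\to S$ and all indices $x$ of $f$, $\phi x$ is defined and is an index of $Ff$. Then: 1. $\mathcal P$ is algebraically complete for realizable endofunctors, i.e. each of them has an initial algebra. More precisely, let $F$ be an endofunctor of $\mathcal P$ tracked by $\phi$, and let $R_0$ be the PER of all $(f,f')\in\mathbb N^2$ such that for all $F$-algebras $A,B,T$ on PERs $R,S,Q$, all indices $a$ and $b$ of the structure maps of $A$ and $B$, and all algebra morphisms $m:A\to T$, $m':B\to T$, we have $fa\in \mathrm{dom}\,R$, $f'b\in\mathrm{dom}\,S$ and $m[fa]_R=m'[f'b]_S$. Then (a) $(f,f')\in R_0$ if and only if $(f,f')\in\bigcap_{R\in\mathcal P}[[FR\to R]\to R]$ and $f$ commutes with all algebra morphisms, i.e. $m[fa]_R=[fb]_S$ for every algebra morphism $m$ from an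 algebra on $R$ with index $a$ to an algebra on $S$ with index $b$ (where $fa\in\mathrm{dom}\,R$ and $fb\in\mathrm{dom}\,S$); (b) writing $\pi_a$ for a number, computed from $a$, that is an index of $\lambda f.fa$, there are indices $c=\lambda xa.\,a(\phi\,\pi_a\,x)$; all of them track one and the same morphism $\gamma:FR_0\to R_0$, and $(R_0,\gamma)$ is an initial $F$-algebra; (c) the $\pi_a$ are indices of the components $R_0\to R$ of a limiting cone over the underlying object functor $F\text{-alg}\to\mathcal P$, and these components are algebra morphisms from $(R_0,\gamma)$. 2. $\mathcal C$ is a reflective (not full) subcategory of $\mathcal P$: the inclusion functor $\mathcal C\to\mathcal P$ has a left adjoint. 3. $\mathcal C$ is algebraically complete for realizable endofunctors. 4. $\mathcal C$ is algebraically compact for realizable endofunctors: each realizable endofunctor of $\mathcal C$ has an initial algebra whose structure map is an isomorphism, and the inverse of this structure map is a final coalgebra. -/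

import Mathlib

open CategoryTheory CategoryTheory.Limits CategoryTheory.Endofunctor

namespace Realizability

/-- Kleene application: `app n m` is the value (if any) of the `n`-th partial recursive
function at `m`. -/
def app (n m : ℕ) : Part ℕ := (Denumerable.ofNat Nat.Partrec.Code n).eval m

/-- A partial equivalence relation on the natural numbers. -/
structure PER where
  rel : ℕ → ℕ → Prop
  symm : ∀ {n m : ℕ}, rel n m → rel m n
  trans : ∀ {n m k : ℕ}, rel n m → rel m k → rel n k

namespace PER

/-- The equivalence relation that a PER induces on its domain `{n | R n n}`. -/
def setoid (R : PER) : Setoid {n : ℕ // R.rel n n} where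
  r x y := R.rel x.1 y.1
  iseqv := ⟨fun x => x.2, fun h => R.symm h, fun h k => R.trans h k⟩

/-- The quotient `dom R / R`. -/
def Class (R : PER) : Type := Quotient R.setoid

/-- The class `[n]_R` of an element `n` of the domain of `R`. -/
def cls (R : PER) (n : ℕ) (hn : R.rel n n) : R.Class := Quotient.mk R.setoid ⟨n, hn⟩

theorem cls_eq_iff (R : PER) {n m : ℕ} (hn : R.rel n n) (hm : R.rel m m) :
    R.cls n hn = R.cls m hm ↔ R.rel n m :=
  ⟨fun h => Quotient.exact h, fun h => Quotient.sound (s := R.setoid) h⟩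

/-- The partial function `φ` tracks `f : dom R / R → dom S / S`: for every `n` in the domain
of `R`, `φ n` is defined, it is in the domain of `S`, and `f [n]_R = [φ n]_S`. -/
def TracksFun {R S : PER} (φ : ℕ →. ℕ) (f : R.Class → S.Class) : Prop :=
  ∀ (n : ℕ) (hn : R.rel n n), ∃ (m : ℕ) (hm : S.rel m m), m ∈ φ n ∧ f (R.cls n hn) = S.cls m hm

/-- A morphism of PERs: a function between the quotients that is tracked by some partial
recursive function. -/
@[ext]
structure Hom (R S : PER) where
  toFun : R.Class → S.Class
  tracked : ∃ φ : ℕ →. ℕ, Nat.Partrec φ ∧ TracksFun φ toFun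

instance : Category PER where
  Hom := Hom
  id R := ⟨id, fun n => Part.some n, Nat.Partrec.some, fun n hn => ⟨n, hn, Part.mem_some n, rfl⟩⟩
  comp {R S T} f g := ⟨g.toFun ∘ f.toFun, by
    obtain ⟨φ, hφ, hf⟩ := f.tracked
    obtain ⟨ψ, hψ, hg⟩ := g.tracked
    refine ⟨fun n => (φ n).bind ψ, hψ.comp hφ, fun n hn => ?_⟩
    obtain ⟨m, hm, hm1, hm2⟩ := hf n hn
    obtain ⟨k, hk, hk1, hk2⟩ := hg m hm
    exact ⟨k, hk, Part.mem_bind hm1 hk1, by simp only [Function.comp, hm2, hk2]⟩⟩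

/-- `x` is an index of the morphism `f`, that is, `f = [x]_{R → S}`. -/
def Tracks {R S : PER} (x : ℕ) (f : R ⟶ S) : Prop := TracksFun (app x) f.toFun

/-- The exponential PER `[R → S]` of indices of tracking functions; two indices are related
when they track the same morphism. -/
def exp (R S : PER) : PER where
  rel x y := ∀ n m : ℕ, R.rel n m → ∃ k l : ℕ, k ∈ app x n ∧ l ∈ app y m ∧ S.rel k l
  symm h n m hnm := by
    obtain ⟨k, l, hk, hl, hkl⟩ := h m n (R.symm hnm)
    exact ⟨l, k, hl, hk, S.symm hkl⟩
  trans h h' n m hnm := by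
    obtain ⟨k, l, hk, hl, hkl⟩ := h n m hnm
    obtain ⟨l', j, hl', hj, hlj⟩ := h' m m (R.trans (R.symm hnm) hnm)
    have hll : l = l' := Part.mem_unique hl hl'
    subst hll
    exact ⟨k, j, hk, hj, S.trans hkl hlj⟩

end PER

open PER

/-- The partial function `φ` tracks the functor `F`: for every morphism `f` and every index `x`
of `f`, `φ x` is defined and is an index of `F f`. The functors `U` and `V` say which morphism of
PERs underlies a morphism of `C` and of `D`; take `𝟭 PER` for the category of PERs itself. -/
def TracksFunctor {C D : Type} [Category.{0} C] [Category.{0} D] (U : C ⥤ PER) (V : D ⥤ PER)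
    (F : C ⥤ D) (φ : ℕ →. ℕ) : Prop :=
  ∀ (R S : C) (f : R ⟶ S) (x : ℕ), Tracks x (U.map f) → ∃ y ∈ φ x, Tracks y (V.map (F.map f))

/-- An endofunctor is realizable if a single partial recursive function tracks its action on
all hom-sets. -/
def Realizable {C : Type} [Category.{0} C] (U : C ⥤ PER) (F : C ⥤ C) : Prop :=
  ∃ φ : ℕ →. ℕ, Nat.Partrec φ ∧ TracksFunctor U U F φ

/-- Algebraic completeness with respect to a class `W` of endofunctors: all of them have initial
algebras. -/
def AlgebraicallyComplete {C : Type} [Category.{0} C] (W : (C ⥤ C) → Prop) : Prop :=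
  ∀ F : C ⥤ C, W F → ∃ A : Algebra F, Nonempty (IsInitial A)

/-- Algebraic compactness with respect to a class `W` of endofunctors: all of them have an initial
algebra, its structure map is invertible, and the inverse is a final coalgebra. -/
def AlgebraicallyCompact {C : Type} [Category.{0} C] (W : (C ⥤ C) → Prop) : Prop :=
  ∀ F : C ⥤ C, W F → ∃ A : Algebra F, Nonempty (IsInitial A) ∧
    ∃ e : F.obj A.a ≅ A.a, e.hom = A.str ∧
      Nonempty (IsTerminal ({ V := A.a, str := e.inv } : Coalgebra F))

/-- `f` and `f'` give related values at all (indices of) algebras, even after composition with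
algebra morphisms into a third algebra: `(m (f a), m' (f' b)) ∈ T` for all algebras
`(R, a)`, `(S, b)`, `(T, c)` and morphisms `m : (R, a) → (T, c)`, `m' : (S, b) → (T, c)`. -/
def AlgRel (F : PER ⥤ PER) (f f' : ℕ) : Prop :=
  ∀ (A B T : Algebra F) (a b : ℕ), Tracks a A.str → Tracks b B.str →
    ∀ (m : A ⟶ T) (m' : B ⟶ T),
      ∃ (x y : ℕ) (hx : A.a.rel x x) (hy : B.a.rel y y), x ∈ app f a ∧ y ∈ app f' b ∧
        m.f.toFun (A.a.cls x hx) = m'.f.toFun (B.a.cls y hy)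

/-- A morphism of PERs always has an index. -/
theorem exists_tracks {R S : PER} (f : R ⟶ S) : ∃ x : ℕ, Tracks x f := by
  obtain ⟨φ, hφ, h⟩ := f.tracked
  obtain ⟨c, hc⟩ := Nat.Partrec.Code.exists_code.1 hφ
  refine ⟨Encodable.encode c, fun n hn => ?_⟩
  obtain ⟨m, hm, h1, h2⟩ := h n hn
  exact ⟨m, hm, by simpa [app, hc] using h1, h2⟩

/-- The PER `R₀` that carries the initial `F`-algebra. -/
def R0 (F : PER ⥤ PER) : PER where
  rel := AlgRel F
  symm h A B T a b ha hb m m' := by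
    obtain ⟨x, y, hx, hy, h1, h2, h3⟩ := h B A T b a hb ha m' m
    exact ⟨y, x, hy, hx, h2, h1, h3.symm⟩
  trans h h' A B T a b ha hb m m' := by
    obtain ⟨t, ht⟩ := exists_tracks T.str
    obtain ⟨x, y, hx, hy, h1, h2, h3⟩ := h A T T a t ha ht m (𝟙 T)
    obtain ⟨y', z, hy', hz, h4, h5, h6⟩ := h' T B T t b ht hb (𝟙 T) m'
    have hyy : y = y' := Part.mem_unique h2 h4
    subst hyy
    exact ⟨x, z, hx, hz, h1, h5, h3.trans h6⟩

/-- `f` commutes with all algebra morphisms: `m (f a) = f b` in `S` for every morphism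
`m : (R, a) → (S, b)`. -/
def CommutesWithAlgHoms (F : PER ⥤ PER) (f : ℕ) : Prop :=
  ∀ (A B : Algebra F) (a b : ℕ), Tracks a A.str → Tracks b B.str → ∀ m : A ⟶ B,
    ∃ (x y : ℕ) (hx : A.a.rel x x) (hy : B.a.rel y y), x ∈ app f a ∧ y ∈ app f b ∧
      m.f.toFun (A.a.cls x hx) = B.a.cls y hy

/-- `p a` is, effectively in `a`, an index of the evaluation `π_a = λ f. f a`. -/
def IsEvalIndex (p : ℕ → ℕ) : Prop :=
  Computable p ∧ ∀ a f : ℕ, app (p a) f = app f a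

/-- `c` is an index of `λ x a. a (φ π_a x)`, where `p a` is an index of `π_a`. -/
def IsAlgIndex (φ : ℕ →. ℕ) (p : ℕ → ℕ) (c : ℕ) : Prop :=
  ∀ x : ℕ, ∃ g ∈ app c x, ∀ a : ℕ,
    app g a = (φ (p a)).bind fun y => (app y x).bind fun z => app a z

/-- `R` is extensional over the set `B`: it is given by extensional equality of the r.e. sets
`{b ∈ B | n b is defined}`, on a domain that is closed under this equality. In other words, `R` is
a (double negation closed) subobject of the power `Σ^B` of the object of semidecidable truth
values. -/
def ExtensionalOver (B : Set ℕ) (R : PER) : Prop :=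
  (∀ n m : ℕ, R.rel n m → ∀ b ∈ B, ((app n b).Dom ↔ (app m b).Dom)) ∧
  (∀ n m : ℕ, R.rel n n → (∀ b ∈ B, ((app n b).Dom ↔ (app m b).Dom)) → R.rel n m)

/-- `R` is closed under unions of recursive ascending chains in `Σ^B`. -/
def CompleteOver (B : Set ℕ) (R : PER) : Prop :=
  ∀ s : ℕ → ℕ, Computable s → (∀ k, R.rel (s k) (s k)) →
    (∀ k, ∀ b ∈ B, (app (s k) b).Dom → (app (s (k + 1)) b).Dom) →
    ∀ n : ℕ, (∀ b ∈ B, ((app n b).Dom ↔ ∃ k, (app (s k) b).Dom)) → R.rel n n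

/-- `n` is an index of the nowhere defined function. -/
def IsBot (n : ℕ) : Prop := ∀ k : ℕ, ¬ (app n k).Dom

/-- A pointed complete extensional PER. Its least element is the nowhere defined function. -/
structure PCEPER where
  toPER : PER
  exists_base : ∃ B : Set ℕ, ExtensionalOver B toPER ∧ CompleteOver B toPER
  pointed : ∀ n : ℕ, IsBot n → toPER.rel n n

namespace PCEPER

/-- A morphism of PERs is strict if it preserves the least element. -/
def Strict {R S : PCEPER} (f : R.toPER ⟶ S.toPER) : Prop :=
  ∀ (n m : ℕ) (hn : IsBot n) (hm : IsBot m),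
    f.toFun (R.toPER.cls n (R.pointed n hn)) = S.toPER.cls m (S.pointed m hm)

/-- Morphisms of pointed complete extensional PERs are the strict morphisms of PERs. -/
@[ext]
structure Hom (R S : PCEPER) where
  hom : R.toPER ⟶ S.toPER
  strict : Strict hom

instance : Category PCEPER where
  Hom := Hom
  id R := ⟨𝟙 R.toPER, fun n m hn hm => by
    obtain ⟨B, ⟨-, hB⟩, -⟩ := R.exists_base
    exact (R.toPER.cls_eq_iff _ _).2 (hB n m (R.pointed n hn)
      fun b _ => iff_of_false (hn b) (hm b))⟩
  comp {R S T} f g := ⟨f.hom ≫ g.hom, fun n m hn hm => by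
    change g.hom.toFun (f.hom.toFun _) = _
    rw [f.strict n n hn hn, g.strict n m hn hm]⟩

/-- The inclusion of pointed complete extensional PERs into PERs. -/
def incl : PCEPER ⥤ PER where
  obj R := R.toPER
  map f := f.hom

end PCEPER

end Realizability

namespace Realizability

open Nat.Partrec (Code)

/-! ### Indices of partial recursive functions -/

/-! Every initial algebra below is a limit of the forgetful functor from algebras. A family over all
algebras is coded by one number, the index of a partial recursive function of indices of structure
maps, and the limit is the PER of codes of compatible families (`R0`, `lim`). Since a single `φ`
tracks `F`, the maps `F π_A ≫ A.str` are computed uniformly in an index of `A.str`; they give the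
limit its algebra structure (`exists_R0_str`, `exists_mu_str`). The projections are then algebra
morphisms, the projection to the limit itself is the identity, and initiality follows from the cone
equations. The reflection is the same kind of limit, over all morphisms from `R` to pointed CEPERs.

In the category of pointed CEPERs the limit must also be extensional and complete. A family of r.e.
sets is an r.e. set of pairs, and compatibility survives unions of recursive chains because
morphisms are monotone and preserve such unions. This (`Maps.le`, `Maps.isSup`) is an argument of
Rice–Shapiro type with the recursion theorem.

For compactness, codes of strict morphisms form a pointed CEPER `homObj`, on which `f ↦ u ≫ F f ≫ v`
is computable and so has a fixed point, the union of its iterates from the least element. On the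
initial algebra this fixed point is the identity, so morphisms into it are determined by their
composites with the iterates. That makes coalgebra morphisms unique. -/

theorem partrec₂_app : Partrec₂ app :=
  Code.eval_part.comp ((Computable.ofNat Code).comp Computable.fst) Computable.snd

theorem exists_index {ψ : ℕ →. ℕ} (hψ : Partrec ψ) : ∃ c, ∀ x, app c x = ψ x := by
  obtain ⟨c, hc⟩ := Code.exists_code.1 (Partrec.nat_iff.1 hψ)
  exact ⟨Encodable.encode c, fun x => by simp [app, hc]⟩

/-- `cur g a` is an index of `λ b. g ⟨a, b⟩`. -/
def cur (g a : ℕ) : ℕ := Encodable.encode (Code.curry (Denumerable.ofNat Code g) a)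

theorem app_cur (g a b : ℕ) : app (cur g a) b = app g (Nat.pair a b) := by
  simp [app, cur, Code.eval_curry]

theorem computable₂_cur : Computable₂ cur :=
  Computable.encode.comp (Code.primrec₂_curry.to_comp.comp
    ((Computable.ofNat Code).comp Computable.fst) Computable.snd)

theorem exists_smn {ψ : ℕ → ℕ →. ℕ} (hψ : Partrec₂ ψ) :
    ∃ s : ℕ → ℕ, Computable s ∧ ∀ a b, app (s a) b = ψ a b := by
  obtain ⟨c, hc⟩ := exists_index
    (hψ.comp (Computable.fst.comp Computable.unpair) (Computable.snd.comp Computable.unpair))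
  exact ⟨cur c, computable₂_cur.comp (Computable.const c) Computable.id, fun a b => by
    simp [app_cur, hc]⟩

/-- A uniform choice of an index for `λ b. ψ a b`, uncurried once more. -/
theorem exists_smn_cur {ψ : ℕ → ℕ × ℕ →. ℕ} (hψ : Partrec₂ ψ) :
    ∃ s : ℕ → ℕ, Computable s ∧ ∀ x a b, app (cur (s x) a) b = ψ x (a, b) := by
  obtain ⟨s, hs, h⟩ := exists_smn (ψ := fun x n => ψ x n.unpair)
    (hψ.comp Computable.fst (Computable.unpair.comp Computable.snd))
  exact ⟨s, hs, fun x a b => by simp [app_cur, h]⟩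

theorem exists_isBot : ∃ n, IsBot n := by
  obtain ⟨c, hc⟩ := exists_index (ψ := fun _ => Part.none) Partrec.none
  exact ⟨c, fun k => by simp [hc]⟩

theorem app_dom_iff_evaln {n b : ℕ} :
    (app n b).Dom ↔ ∃ k, (Code.evaln k (Denumerable.ofNat Code n) b).isSome := by
  simp only [Part.dom_iff_mem, app, Code.evaln_complete, Option.isSome_iff_exists, Option.mem_def]
  exact exists_comm

theorem computable_evaln_isSome {α : Type} [Primcodable α] {k n b : α → ℕ} (hk : Computable k)
    (hn : Computable n) (hb : Computable b) :
    Computable fun x => (Code.evaln (k x) (Denumerable.ofNat Code (n x)) (b x)).isSome :=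
  Primrec.option_isSome.to_comp.comp (Code.primrec_evaln.to_comp.comp
    ((hk.pair ((Computable.ofNat Code).comp hn)).pair hb))

/-- By the recursion theorem, the members of a union of domains may be selected by a decidable
condition on an index of the union itself. -/
theorem exists_fixed_union {s : ℕ → ℕ} (hs : Computable s) {q : ℕ → ℕ → Bool}
    (hq : Computable₂ q) :
    ∃ t, ∀ b, (app t b).Dom ↔ ∃ k, q t k ∧ (app (s k) b).Dom := by
  -- The search runs over pairs of a member `k` of the union and a number of evaluation steps; after
  -- `fixed_point₂`, the code `c` passed to `q` is that of the search itself.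
  let f : Code → ℕ →. ℕ := fun c b => Nat.rfindOpt fun j =>
    bif q (Encodable.encode c) j.unpair.1 &&
      (Code.evaln j.unpair.2 (Denumerable.ofNat Code (s j.unpair.1)) b).isSome
    then some 0 else none
  have hj1 : Computable fun p : (Code × ℕ) × ℕ => p.2.unpair.1 :=
    Computable.fst.comp (Computable.unpair.comp Computable.snd)
  have hj2 : Computable fun p : (Code × ℕ) × ℕ => p.2.unpair.2 :=
    Computable.snd.comp (Computable.unpair.comp Computable.snd)
  have hf : Partrec₂ f := by
    refine Partrec.rfindOpt (Computable.cond ?_ (Computable.const _) (Computable.const _))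
    refine Primrec.and.to_comp.comp
      (hq.comp (Computable.encode.comp (Computable.fst.comp Computable.fst)) hj1) ?_
    exact computable_evaln_isSome hj2 (hs.comp hj1) (Computable.snd.comp Computable.fst)
  obtain ⟨c, hc⟩ := Code.fixed_point₂ hf
  refine ⟨Encodable.encode c, fun b => ?_⟩
  have h : app (Encodable.encode c) b = f c b := by simp [app, hc]
  rw [h, Nat.rfindOpt_dom]
  simp only [app_dom_iff_evaln]
  constructor
  · rintro ⟨j, a, hj⟩
    rcases hb : (q (Encodable.encode c) j.unpair.1 &&
      (Code.evaln j.unpair.2 (Denumerable.ofNat Code (s j.unpair.1)) b).isSome) with _ | _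
    · simp [hb] at hj
    · rw [Bool.and_eq_true] at hb
      exact ⟨_, hb.1, _, hb.2⟩
  · rintro ⟨k, h1, j, h2⟩
    exact ⟨Nat.pair k j, 0, by simp [h1, h2]⟩

theorem exists_union {s : ℕ → ℕ} (hs : Computable s) :
    ∃ t, ∀ b, (app t b).Dom ↔ ∃ k, (app (s k) b).Dom := by
  obtain ⟨t, ht⟩ := exists_fixed_union hs (q := fun _ _ => true) (Computable.const true)
  exact ⟨t, by simpa using ht⟩

/-! ### Graphs of morphisms -/

namespace PER

theorem left {R : PER} {n m : ℕ} (h : R.rel n m) : R.rel n n := R.trans h (R.symm h)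

theorem right {R : PER} {n m : ℕ} (h : R.rel n m) : R.rel m m := R.trans (R.symm h) h

/-- The graph of a morphism: `n` and `m` are in the domains and `f [n] = [m]`. -/
def Maps {R S : PER} (f : R ⟶ S) (n m : ℕ) : Prop :=
  ∃ (hn : R.rel n n) (hm : S.rel m m), f.toFun (R.cls n hn) = S.cls m hm

namespace Maps

variable {R S T : PER} {f : R ⟶ S} {g : S ⟶ T} {n m n' m' k : ℕ}

theorem dom (h : Maps f n m) : R.rel n n := h.1

theorem cod (h : Maps f n m) : S.rel m m := h.2.1

theorem congr (h : Maps f n m) (hn : R.rel n n') (hm : S.rel m m') : Maps f n' m' := by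
  obtain ⟨h1, h2, h3⟩ := h
  refine ⟨right hn, right hm, ?_⟩
  rw [← (R.cls_eq_iff h1 (right hn)).2 hn, h3]
  exact (S.cls_eq_iff _ _).2 hm

theorem rel (h : Maps f n m) (h' : Maps f n' m') (hn : R.rel n n') : S.rel m m' := by
  obtain ⟨h1, h2, h3⟩ := h.congr hn h.cod
  obtain ⟨h4, h5, h6⟩ := h'
  exact (S.cls_eq_iff h2 h5).1 (h3.symm.trans h6)

theorem comp (h : Maps f n m) (h' : Maps g m k) : Maps (f ≫ g) n k := by
  obtain ⟨h1, h2, h3⟩ := h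
  obtain ⟨h4, h5, h6⟩ := h'
  exact ⟨h1, h5, (congrArg g.toFun h3).trans h6⟩

theorem id (h : R.rel n m) : Maps (𝟙 R) n m := ⟨left h, right h, (R.cls_eq_iff _ _).2 h⟩

theorem exists_of_dom (f : R ⟶ S) (hn : R.rel n n) : ∃ m, Maps f n m := by
  obtain ⟨m, hm⟩ := Quotient.exists_rep (f.toFun (R.cls n hn))
  exact ⟨m.1, hn, m.2, hm.symm⟩

theorem of_comp (h : Maps (f ≫ g) n k) (h' : Maps f n m) : Maps g m k := by
  obtain ⟨l, hl⟩ := exists_of_dom g h'.cod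
  exact hl.congr h'.cod ((h'.comp hl).rel h h.dom)

theorem hom_ext {f g : R ⟶ S} (h : ∀ n, R.rel n n → ∃ m, Maps f n m ∧ Maps g n m) : f = g := by
  refine Hom.ext (funext fun c => ?_)
  obtain ⟨n, rfl⟩ := Quotient.exists_rep c
  obtain ⟨m, ⟨h1, h2, h3⟩, h4, h5, h6⟩ := h n.1 n.2
  exact h3.trans h6.symm

end Maps

theorem tracks_iff {R S : PER} {x : ℕ} {f : R ⟶ S} :
    Tracks x f ↔ ∀ n, R.rel n n → ∃ m ∈ app x n, Maps f n m :=
  ⟨fun h n hn => by obtain ⟨m, hm, h1, h2⟩ := h n hn; exact ⟨m, h1, hn, hm, h2⟩,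
    fun h n hn => by obtain ⟨m, h1, _, h2, h3⟩ := h n hn; exact ⟨m, h2, h1, h3⟩⟩

theorem Tracks.exists_maps {R S : PER} {x n : ℕ} {f : R ⟶ S} (h : Tracks x f) (hn : R.rel n n) :
    ∃ m ∈ app x n, Maps f n m := tracks_iff.1 h n hn

/-- A partial recursive function that respects the relations tracks a morphism. -/
theorem exists_hom {R S : PER} {φ : ℕ →. ℕ} (hφ : Nat.Partrec φ)
    (h : ∀ n m, R.rel n m → ∃ k l, k ∈ φ n ∧ l ∈ φ m ∧ S.rel k l) :
    ∃ f : R ⟶ S, ∀ n k, R.rel n n → k ∈ φ n → Maps f n k := by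
  have hd : ∀ n, R.rel n n → ∃ k, k ∈ φ n ∧ S.rel k k := fun n hn => by
    obtain ⟨k, l, hk, -, hkl⟩ := h n n hn
    exact ⟨k, hk, left hkl⟩
  choose! u hu1 hu2 using hd
  have hu : ∀ n m, R.rel n m → S.rel (u n) (u m) := fun n m hnm => by
    obtain ⟨k, l, hk, hl, hkl⟩ := h n m hnm
    rwa [Part.mem_unique (hu1 n (left hnm)) hk, Part.mem_unique (hu1 m (right hnm)) hl]
  let f : R.Class → S.Class := fun c => Quotient.liftOn c (fun n => S.cls (u n.1) (hu2 n.1 n.2))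
    fun a b hab => (S.cls_eq_iff _ _).2 (hu _ _ hab)
  refine ⟨⟨f, φ, hφ, fun n hn => ⟨u n, hu2 n hn, hu1 n hn, rfl⟩⟩, fun n k hn hk => ?_⟩
  obtain rfl := Part.mem_unique hk (hu1 n hn)
  exact ⟨hn, hu2 n hn, rfl⟩

/-- A computable function that respects the relations tracks a morphism. -/
theorem exists_hom_of_computable {R S : PER} {u : ℕ → ℕ} (hu : Computable u)
    (h : ∀ n m, R.rel n m → S.rel (u n) (u m)) :
    ∃ f : R ⟶ S, ∀ n, R.rel n n → Maps f n (u n) := by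
  obtain ⟨f, hf⟩ := exists_hom (R := R) (S := S) (Partrec.nat_iff.1 hu)
    fun n m hnm => ⟨u n, u m, Part.mem_some _, Part.mem_some _, h n m hnm⟩
  exact ⟨f, fun n hn => hf n _ hn (Part.mem_some _)⟩

end PER

open PER

/-! ### Initial algebras in the category of PERs -/

section R0

variable {F : PER ⥤ PER} {φ : ℕ →. ℕ} {f f' : ℕ}

theorem commutesWithAlgHoms_iff : CommutesWithAlgHoms F f ↔
    ∀ (A B : Algebra F) (a b : ℕ), Tracks a A.str → Tracks b B.str → ∀ m : A ⟶ B,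
      ∃ x y, x ∈ app f a ∧ y ∈ app f b ∧ Maps m.f x y := by
  refine forall₄_congr fun A B a b => forall₃_congr fun ha hb m => ?_
  constructor
  · rintro ⟨x, y, hx, hy, h1, h2, h3⟩
    exact ⟨x, y, h1, h2, hx, hy, h3⟩
  · rintro ⟨x, y, h1, h2, hx, hy, h3⟩
    exact ⟨x, y, hx, hy, h1, h2, h3⟩

theorem algRel_iff : AlgRel F f f' ↔
    ∀ (A B T : Algebra F) (a b : ℕ), Tracks a A.str → Tracks b B.str →
      ∀ (m : A ⟶ T) (m' : B ⟶ T), ∃ x y z, x ∈ app f a ∧ y ∈ app f' b ∧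
        Maps m.f x z ∧ Maps m'.f y z := by
  refine forall₅_congr fun A B T a b => forall₄_congr fun ha hb m m' => ?_
  constructor
  · rintro ⟨x, y, hx, hy, h1, h2, h3⟩
    obtain ⟨z, hz⟩ := Maps.exists_of_dom m.f hx
    refine ⟨x, y, z, h1, h2, hz, hy, hz.cod, h3.symm.trans ?_⟩
    exact hz.2.2
  · rintro ⟨x, y, z, h1, h2, ⟨hx, hz, h3⟩, hy, _, h4⟩
    exact ⟨x, y, hx, hy, h1, h2, h3.trans h4.symm⟩

theorem R0_rel_iff : (R0 F).rel f f' ↔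
    CommutesWithAlgHoms F f ∧ ∀ (A : Algebra F) (a : ℕ), Tracks a A.str →
      ∃ x y, x ∈ app f a ∧ y ∈ app f' a ∧ A.a.rel x y := by
  constructor
  · intro h
    refine ⟨commutesWithAlgHoms_iff.2 fun A B a b ha hb m => ?_, fun A a ha => ?_⟩
    · obtain ⟨x, y, z, hx, hy, h1, h2⟩ := algRel_iff.1 (left h) A B B a b ha hb m (𝟙 B)
      exact ⟨x, y, hx, hy, h1.congr h1.dom (h2.rel (Maps.id h2.dom) h2.dom)⟩
    · obtain ⟨x, y, z, hx, hy, h1, h2⟩ := algRel_iff.1 h A A A a a ha ha (𝟙 A) (𝟙 A)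
      exact ⟨x, y, hx, hy, A.a.trans ((Maps.id h1.dom).rel h1 h1.dom)
        (h2.rel (Maps.id h2.dom) h2.dom)⟩
  · rintro ⟨h, h'⟩
    refine algRel_iff.2 fun A B T a b ha hb m m' => ?_
    obtain ⟨t, ht⟩ := exists_tracks T.str
    rw [commutesWithAlgHoms_iff] at h
    -- Commutation is only known for `f`: its value at an index of `T.str` is the common image of `f
    -- a` and `f b`, and `f' b` is related to `f b`.
    obtain ⟨x, z, hx, hz, h1⟩ := h A T a t ha ht m
    obtain ⟨y, z', hy, hz', h2⟩ := h B T b t hb ht m'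
    obtain rfl := Part.mem_unique hz hz'
    obtain ⟨w, y', hw, hy', h3⟩ := h' B b hb
    obtain rfl := Part.mem_unique hy hw
    exact ⟨x, y', z, hx, hy', h1, h2.congr h3 h2.cod⟩

theorem exists_tracks_of_exp {R S : PER} {x y : ℕ} (h : (exp R S).rel x y) :
    ∃ f : R ⟶ S, Tracks x f ∧ Tracks y f := by
  obtain ⟨f, hf⟩ := exists_hom (Partrec.nat_iff.1 (partrec₂_app.comp (Computable.const x)
    Computable.id)) (left h)
  refine ⟨f, tracks_iff.2 fun n hn => ?_, tracks_iff.2 fun n hn => ?_⟩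
  · obtain ⟨k, l, hk, hl, -⟩ := h n n hn
    exact ⟨k, hk, hf n k hn hk⟩
  · obtain ⟨k, l, hk, hl, hkl⟩ := h n n hn
    exact ⟨l, hl, (hf n k hn hk).congr hn hkl⟩

theorem exp_rel_of_tracks {R S : PER} {x y : ℕ} {f : R ⟶ S} (hx : Tracks x f)
    (hy : Tracks y f) : (exp R S).rel x y := fun n m hnm => by
  obtain ⟨k, hk, h1⟩ := hx.exists_maps (left hnm)
  obtain ⟨l, hl, h2⟩ := hy.exists_maps (right hnm)
  exact ⟨k, l, hk, hl, h1.rel h2 hnm⟩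

theorem R0_rel_iff_exp : (R0 F).rel f f' ↔
    (∀ R : PER, (exp (exp (F.obj R) R) R).rel f f') ∧ CommutesWithAlgHoms F f := by
  rw [R0_rel_iff, and_comm]
  refine and_congr_left fun hf => ⟨fun h R a b hab => ?_, fun h A a ha => ?_⟩
  · obtain ⟨s, ha, hb⟩ := exists_tracks_of_exp hab
    obtain ⟨x, y, hx, hy, h1⟩ := h ⟨R, s⟩ a ha
    obtain ⟨z, w, hz, hw, h2⟩ := h ⟨R, s⟩ b hb
    -- `a` and `b` may be different indices of `s`; commuting with the identity relates `f a` to `f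
    -- b`.
    obtain ⟨u, v, hu, hv, h3⟩ := commutesWithAlgHoms_iff.1 hf ⟨R, s⟩ ⟨R, s⟩ a b ha hb (𝟙 _)
    obtain rfl := Part.mem_unique hx hu
    obtain rfl := Part.mem_unique hz hv
    exact ⟨x, w, hx, hw, R.trans ((Maps.id h3.dom).rel h3 h3.dom) h2⟩
  · exact h A.a a a (exp_rel_of_tracks ha ha)

theorem exists_isEvalIndex : ∃ p, IsEvalIndex p := by
  obtain ⟨s, hs, h⟩ := exists_smn (ψ := fun a f => app f a)
    (partrec₂_app.comp Computable.snd Computable.fst)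
  exact ⟨s, hs, h⟩

theorem exists_isAlgIndex (hφ : Nat.Partrec φ) {p : ℕ → ℕ} (hp : Computable p) :
    ∃ c, IsAlgIndex φ p c := by
  obtain ⟨s, hs, h⟩ := exists_smn
    (ψ := fun x a => (φ (p a)).bind fun y => (app y x).bind fun z => app a z) (by
      refine Partrec.bind ((Partrec.nat_iff.2 hφ).comp (hp.comp Computable.snd)) ?_
      refine Partrec.bind (partrec₂_app.comp Computable.snd
        (Computable.fst.comp Computable.fst)) ?_
      exact partrec₂_app.comp (Computable.snd.comp (Computable.fst.comp Computable.fst))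
        Computable.snd)
  obtain ⟨c, hc⟩ := exists_index (ψ := s) hs
  exact ⟨c, fun x => ⟨s x, by simp [hc], h x⟩⟩

theorem R0_hom_ext {X : PER} {u v : X ⟶ R0 F} (h : ∀ n f f', Maps u n f → Maps v n f' →
    ∀ (A : Algebra F) (a : ℕ), Tracks a A.str → ∃ x y, x ∈ app f a ∧ y ∈ app f' a ∧ A.a.rel x y) :
    u = v := by
  refine Maps.hom_ext fun n hn => ?_
  obtain ⟨f, hf⟩ := Maps.exists_of_dom u hn
  obtain ⟨f', hv⟩ := Maps.exists_of_dom v hn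
  refine ⟨f', hf.congr hn (R0_rel_iff.2 ⟨(R0_rel_iff.1 hf.cod).1, h n f f' hf hv⟩), hv⟩

/-- The evaluation morphisms `[f] ↦ [f a]`. -/
theorem exists_R0_proj (A : Algebra F) : ∃ π : R0 F ⟶ A.a, ∀ f a x, (R0 F).rel f f →
    Tracks a A.str → x ∈ app f a → Maps π f x := by
  obtain ⟨a, ha⟩ := exists_tracks A.str
  obtain ⟨π, hπ⟩ := exists_hom (R := R0 F) (S := A.a)
    (Partrec.nat_iff.1 (partrec₂_app.comp Computable.id (Computable.const a)))
    (fun n m h => (R0_rel_iff.1 h).2 A a ha)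
  refine ⟨π, fun f b x hf hb hx => ?_⟩
  obtain ⟨y, z, hy, hz, h⟩ := commutesWithAlgHoms_iff.1 (R0_rel_iff.1 hf).1 A A a b ha hb (𝟙 A)
  obtain rfl := Part.mem_unique hx hz
  exact (hπ f y hf hy).congr hf ((Maps.id h.dom).rel h h.dom)

/-- The projection of the carrier `R0 F` to the carrier of an algebra. -/
noncomputable def R0proj (A : Algebra F) : R0 F ⟶ A.a := (exists_R0_proj A).choose

theorem maps_R0proj (A : Algebra F) {f a x : ℕ} (hf : (R0 F).rel f f) (ha : Tracks a A.str)
    (hx : x ∈ app f a) : Maps (R0proj A) f x := (exists_R0_proj A).choose_spec f a x hf ha hx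

theorem R0_exists_app {f a : ℕ} (hf : (R0 F).rel f f) {A : Algebra F} (ha : Tracks a A.str) :
    ∃ x, x ∈ app f a := by
  obtain ⟨x, y, hx, -⟩ := (R0_rel_iff.1 hf).2 A a ha
  exact ⟨x, hx⟩

theorem tracks_R0proj {p : ℕ → ℕ} (hp : IsEvalIndex p) {A : Algebra F} {a : ℕ}
    (ha : Tracks a A.str) : Tracks (p a) (R0proj A) := by
  refine tracks_iff.2 fun f hf => ?_
  obtain ⟨x, hx⟩ := R0_exists_app hf ha
  exact ⟨x, by rwa [hp.2], maps_R0proj A hf ha hx⟩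

theorem R0proj_comp {A B : Algebra F} (m : A ⟶ B) : R0proj A ≫ m.f = R0proj B := by
  obtain ⟨a, ha⟩ := exists_tracks A.str
  obtain ⟨b, hb⟩ := exists_tracks B.str
  refine Maps.hom_ext fun f hf => ?_
  obtain ⟨x, y, hx, hy, h⟩ := commutesWithAlgHoms_iff.1 (R0_rel_iff.1 hf).1 A B a b ha hb m
  exact ⟨y, (maps_R0proj A hf ha hx).comp h, maps_R0proj B hf hb hy⟩

/-- An element of `R0 F` is determined by its values at indices of algebras, and these represent its
images under the projections. -/
theorem R0_joint_mono {X : PER} {u v : X ⟶ R0 F}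
    (h : ∀ A, u ≫ R0proj A = v ≫ R0proj A) : u = v := by
  refine R0_hom_ext fun n f f' hf hf' A a ha => ?_
  obtain ⟨x, hx⟩ := R0_exists_app hf.cod ha
  obtain ⟨y, hy⟩ := R0_exists_app hf'.cod ha
  refine ⟨x, y, hx, hy, ?_⟩
  have h1 := hf.comp (maps_R0proj A hf.cod ha hx)
  rw [h] at h1
  exact h1.rel (hf'.comp (maps_R0proj A hf'.cod ha hy)) hf.dom

/-- The value of `c` at `n` is the family whose component at `A` is the image of `n` under `F.map
(R0proj A) ≫ A.str`, because `φ` turns the index `p a` of the projection into one of its image under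
`F`. Naturality of the projections makes the family compatible. -/
theorem exists_R0_str (hF : TracksFunctor (𝟭 PER) (𝟭 PER) F φ) {p : ℕ → ℕ}
    (hp : IsEvalIndex p) {c : ℕ} (hc : IsAlgIndex φ p c) :
    ∃ γ : F.obj (R0 F) ⟶ R0 F, Tracks c γ ∧
      ∀ A, γ ≫ R0proj A = F.map (R0proj A) ≫ A.str := by
  have key : ∀ (A : Algebra F) (a n : ℕ), Tracks a A.str → (F.obj (R0 F)).rel n n →
      ∀ g ∈ app c n, ∃ x ∈ app g a, Maps (F.map (R0proj A) ≫ A.str) n x := by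
    intro A a n ha hn g hg
    obtain ⟨g', hg', h⟩ := hc n
    obtain rfl := Part.mem_unique hg hg'
    obtain ⟨y, hy, hyt⟩ := hF _ _ (R0proj A) (p a) (tracks_R0proj hp ha)
    obtain ⟨z, hz, h1⟩ := hyt.exists_maps hn
    obtain ⟨x, hx, h2⟩ := ha.exists_maps h1.cod
    exact ⟨x, by rw [h]; exact Part.mem_bind hy (Part.mem_bind hz hx), h1.comp h2⟩
  have hdom : ∀ n g, (F.obj (R0 F)).rel n n → g ∈ app c n → CommutesWithAlgHoms F g := by
    intro n g hn hg
    refine commutesWithAlgHoms_iff.2 fun A B a b ha hb m => ?_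
    obtain ⟨x, hx, h1⟩ := key A a n ha hn g hg
    obtain ⟨y, hy, h2⟩ := key B b n hb hn g hg
    refine ⟨x, y, hx, hy, Maps.of_comp ?_ h1⟩
    rwa [Category.assoc, ← m.h, ← Category.assoc, ← F.map_comp, R0proj_comp]
  obtain ⟨γ, hγ⟩ := exists_hom (R := F.obj (R0 F)) (S := R0 F) (φ := app c)
    (Partrec.nat_iff.1 (partrec₂_app.comp (Computable.const c) Computable.id)) (by
      intro n m hnm
      obtain ⟨g, hg, -⟩ := hc n
      obtain ⟨g', hg', -⟩ := hc m
      refine ⟨g, g', hg, hg', R0_rel_iff.2 ⟨hdom n g (left hnm) hg, fun A a ha => ?_⟩⟩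
      obtain ⟨x, hx, h1⟩ := key A a n ha (left hnm) g hg
      obtain ⟨y, hy, h2⟩ := key A a m ha (right hnm) g' hg'
      exact ⟨x, y, hx, hy, h1.rel h2 hnm⟩)
  refine ⟨γ, tracks_iff.2 fun n hn => ?_, fun A => Maps.hom_ext fun n hn => ?_⟩
  · obtain ⟨g, hg, -⟩ := hc n
    exact ⟨g, hg, hγ n g hn hg⟩
  · obtain ⟨a, ha⟩ := exists_tracks A.str
    obtain ⟨g, hg, -⟩ := hc n
    obtain ⟨x, hx, h1⟩ := key A a n ha hn g hg
    exact ⟨x, (hγ n g hn hg).comp (maps_R0proj A (hγ n g hn hg).cod ha hx), h1⟩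

/-- The projections are algebra morphisms out of `(R0 F, γ)`, so the cone equations show that this
endomorphism is absorbed by every projection; joint monicity does the rest. -/
theorem R0proj_self {γ : F.obj (R0 F) ⟶ R0 F}
    (hγ : ∀ A, γ ≫ R0proj A = F.map (R0proj A) ≫ A.str) :
    R0proj (⟨R0 F, γ⟩ : Algebra F) = 𝟙 (R0 F) :=
  R0_joint_mono fun A => by
    have := R0proj_comp (A := ⟨R0 F, γ⟩) (B := A) ⟨R0proj A, (hγ A).symm⟩
    rw [Category.id_comp]
    exact this

/-- `R0 F` carries an initial algebra. -/
noncomputable def R0IsInitial {γ : F.obj (R0 F) ⟶ R0 F}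
    (hγ : ∀ A, γ ≫ R0proj A = F.map (R0proj A) ≫ A.str) :
    IsInitial (⟨R0 F, γ⟩ : Algebra F) :=
  IsInitial.ofUniqueHom (fun A => ⟨R0proj A, (hγ A).symm⟩) fun A m => by
    ext1
    have := R0proj_comp m
    rw [R0proj_self hγ, Category.id_comp] at this
    exact this

/-- The evaluations form a cone. -/
noncomputable def R0cone (F : PER ⥤ PER) :
    (Functor.const (Algebra F)).obj (R0 F) ⟶ Algebra.forget F where
  app A := R0proj A
  naturality _ _ m := (Category.id_comp _).trans (R0proj_comp m).symm

/-- The evaluations form a limiting cone. -/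
noncomputable def R0IsLimit {γ : F.obj (R0 F) ⟶ R0 F}
    (hγ : ∀ A, γ ≫ R0proj A = F.map (R0proj A) ≫ A.str) :
    IsLimit (⟨R0 F, R0cone F⟩ : Cone (Algebra.forget F)) where
  -- The indexing category has the initial object `(R0 F, γ)`, so the leg of a cone there is already
  -- the lift.
  lift s := s.π.app ⟨R0 F, γ⟩
  fac s A := by
    let m : (⟨R0 F, γ⟩ : Algebra F) ⟶ A := ⟨R0proj A, (hγ A).symm⟩
    exact s.w m
  uniq s l hl := (Category.comp_id l).symm.trans
    ((congrArg (l ≫ ·) (R0proj_self hγ).symm).trans (hl ⟨R0 F, γ⟩))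

end R0

theorem initialAlgebra_PER (F : PER ⥤ PER) (φ : ℕ →. ℕ) (hφ : Nat.Partrec φ)
    (hF : TracksFunctor (𝟭 PER) (𝟭 PER) F φ) :
    ∃ γ : F.obj (R0 F) ⟶ R0 F,
      (∃ (p : ℕ → ℕ) (c : ℕ), IsEvalIndex p ∧ IsAlgIndex φ p c) ∧
      (∀ (p : ℕ → ℕ) (c : ℕ), IsEvalIndex p → IsAlgIndex φ p c → Tracks c γ) ∧
      Nonempty (IsInitial ({ a := R0 F, str := γ } : Algebra F)) ∧
      ∃ π : (Functor.const (Algebra F)).obj (R0 F) ⟶ Algebra.forget F,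
        (∀ p : ℕ → ℕ, IsEvalIndex p → ∀ (A : Algebra F) (a : ℕ), Tracks a A.str →
          Tracks (R := R0 F) (S := A.a) (p a) (π.app A)) ∧
        (∀ A : Algebra F, γ ≫ π.app A = F.map (π.app A) ≫ A.str) ∧
        Nonempty (IsLimit ({ pt := R0 F, π := π } : Cone (Algebra.forget F))) := by
  obtain ⟨p, hp⟩ := exists_isEvalIndex
  obtain ⟨c, hc⟩ := exists_isAlgIndex hφ hp.1
  obtain ⟨γ, -, hγ⟩ := exists_R0_str hF hp hc
  refine ⟨γ, ⟨p, c, hp, hc⟩, fun p' c' hp' hc' => ?_, ⟨R0IsInitial hγ⟩, R0cone F,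
    fun p hp A a ha => tracks_R0proj hp ha, hγ, ⟨R0IsLimit hγ⟩⟩
  -- The equations with the projections mention neither `p` nor `c`, and they determine the
  -- structure map.
  obtain ⟨γ', h1, h2⟩ := exists_R0_str hF hp' hc'
  rwa [R0_joint_mono fun A => (hγ A).trans (h2 A).symm]

theorem algebraicallyComplete_PER : AlgebraicallyComplete (Realizable (𝟭 PER)) := by
  rintro F ⟨φ, hφ, hF⟩
  obtain ⟨γ, -, -, h, -⟩ := initialAlgebra_PER F φ hφ hF
  exact ⟨_, h⟩

/-! ### Continuity of morphisms between complete extensional PERs -/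

namespace PCEPER

/-- A set over which a pointed complete extensional PER is extensional and complete. -/
noncomputable def base (S : PCEPER) : Set ℕ := S.exists_base.choose

/-- Inclusion of the domains of the `n`-th and the `m`-th function within the base. -/
def le (S : PCEPER) (n m : ℕ) : Prop := ∀ b ∈ S.base, (app n b).Dom → (app m b).Dom

/-- Within the base, the domain of the `n`-th function is the union of those of a sequence. -/
def IsSup (S : PCEPER) (s : ℕ → ℕ) (n : ℕ) : Prop :=
  ∀ b ∈ S.base, (app n b).Dom ↔ ∃ k, (app (s k) b).Dom

variable {S T : PCEPER} {n m n' m' : ℕ} {s s' : ℕ → ℕ}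

theorem dom_iff (h : S.toPER.rel n m) {b : ℕ} (hb : b ∈ S.base) :
    (app n b).Dom ↔ (app m b).Dom := S.exists_base.choose_spec.1.1 n m h b hb

theorem rel_of_dom_iff (hn : S.toPER.rel n n)
    (h : ∀ b ∈ S.base, ((app n b).Dom ↔ (app m b).Dom)) : S.toPER.rel n m :=
  S.exists_base.choose_spec.1.2 n m hn h

theorem rel_of_app_eq (hn : S.toPER.rel n n) (h : ∀ b, app m b = app n b) : S.toPER.rel n m :=
  rel_of_dom_iff hn fun b _ => by rw [h]

theorem IsSup.dom (h : S.IsSup s n) (hs : Computable s) (hd : ∀ k, S.toPER.rel (s k) (s k))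
    (hle : ∀ k, S.le (s k) (s (k + 1))) : S.toPER.rel n n :=
  S.exists_base.choose_spec.2 s hs hd hle n h

theorem rel_of_isBot (hn : IsBot n) (hm : IsBot m) : S.toPER.rel n m :=
  rel_of_dom_iff (S.pointed n hn) fun b _ => iff_of_false (hn b) (hm b)

theorem le_of_chain (h : ∀ k, S.le (s k) (s (k + 1))) {i j : ℕ} (hij : i ≤ j) :
    S.le (s i) (s j) := by
  induction hij with
  | refl => exact fun _ _ => id
  | step _ ih => exact fun b hb hd => h _ b hb (ih b hb hd)

/-- For a fixed `b`, whether the domain of a value `f [u]` contains `b` is semidecidable in `u`. -/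
theorem exists_test (f : S.toPER ⟶ T.toPER) {b : ℕ} (hb : b ∈ T.base) :
    ∃ d, ∀ u v, Maps f u v → ((app d u).Dom ↔ (app v b).Dom) := by
  obtain ⟨x, hx⟩ := exists_tracks f
  obtain ⟨d, hd⟩ := exists_index (ψ := fun u => (app x u).bind fun y => app y b)
    (Partrec.bind (partrec₂_app.comp (Computable.const x) Computable.id)
      (partrec₂_app.comp Computable.snd (Computable.const b)))
  refine ⟨d, fun u v huv => ?_⟩
  obtain ⟨y, hy, h⟩ := hx.exists_maps huv.dom
  rw [hd, Part.eq_some_iff.2 hy, Part.bind_some]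
  exact dom_iff (h.rel huv h.dom) hb

/-- If `b` separates the values the wrong way, let `t` enumerate the domain of `n` and, once the
test for `b` halts on `t` itself, also that of `n'`. If the test halts, `t` is equivalent to `n'`,
where it must not halt; otherwise `t` is equivalent to `n`, where it must. -/
theorem _root_.Realizability.PER.Maps.le {f : S.toPER ⟶ T.toPER} (h : Maps f n m)
    (h' : Maps f n' m') (hle : S.le n n') : T.le m m' := by
  intro b hb hm
  by_contra hm'
  obtain ⟨d, hd⟩ := exists_test f hb
  have hs : Computable fun k : ℕ => if k = 0 then n else n' :=
    (Primrec.ite (Primrec.eq.comp Primrec.id (Primrec.const 0)) (Primrec.const n)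
      (Primrec.const n')).to_comp
  have hq : Computable₂ fun t k : ℕ =>
      decide (k = 0) || (Code.evaln k (Denumerable.ofNat Code d) t).isSome :=
    Primrec.or.to_comp.comp
      ((Primrec.eq (α := ℕ)).decide.to_comp.comp Computable.snd (Computable.const 0))
      (computable_evaln_isSome Computable.snd (Computable.const d) Computable.fst)
  obtain ⟨t, ht⟩ := exists_fixed_union hs hq
  by_cases hdt : (app d t).Dom
  · obtain ⟨k, hk⟩ := app_dom_iff_evaln.1 hdt
    -- Evaluation with bound `0` never succeeds, so the slot `k = 0` is free for `n`.
    have hk0 : k ≠ 0 := by rintro rfl; simp [Code.evaln] at hk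
    have hrel : S.toPER.rel n' t := by
      refine rel_of_dom_iff h'.dom fun c hc => ⟨fun hn' => ?_, fun htc => ?_⟩
      · exact (ht c).2 ⟨k, by simp [hk], by simpa [hk0] using hn'⟩
      · obtain ⟨j, -, hj⟩ := (ht c).1 htc
        split_ifs at hj
        · exact hle c hc hj
        · exact hj
    exact hm' ((hd _ _ (h'.congr hrel h'.cod)).1 hdt)
  · have hrel : S.toPER.rel n t := by
      refine rel_of_dom_iff h.dom fun c hc => ⟨fun hn => ?_, fun htc => ?_⟩
      · exact (ht c).2 ⟨0, by simp, by simpa using hn⟩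
      · obtain ⟨j, hj, hj'⟩ := (ht c).1 htc
        rcases Bool.or_eq_true_iff.1 hj with hj | hj
        · simpa [of_decide_eq_true hj] using hj'
        · exact absurd (app_dom_iff_evaln.2 ⟨j, hj⟩) hdt
    exact hdt ((hd _ _ (h.congr hrel h.cod)).2 hm)

/-- Monotonicity gives one inclusion. If `b` lies in the value at `n` but in none at `s k`, let `t`
follow the chain until the test for `b` halts on `t` itself. If it halts, `t` is equivalent to some
`s j`; otherwise to `n`. Both are contradictory. -/
theorem _root_.Realizability.PER.Maps.isSup {f : S.toPER ⟶ T.toPER} (hs : Computable s)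
    (hle : ∀ k, S.le (s k) (s (k + 1))) (h : ∀ k, Maps f (s k) (s' k)) (hn : S.IsSup s n)
    (hm : T.IsSup s' m) : Maps f n m := by
  have hdom : S.toPER.rel n n := hn.dom hs (fun k => (h k).dom) hle
  obtain ⟨v, hv⟩ := Maps.exists_of_dom f hdom
  refine hv.congr hdom (rel_of_dom_iff hv.cod fun b hb => ?_)
  rw [hm b hb]
  refine ⟨fun hvb => ?_, fun ⟨k, hk⟩ => (h k).le hv (fun c hc hk => (hn c hc).2 ⟨k, hk⟩) b hb hk⟩
  by_contra hno
  obtain ⟨d, hd⟩ := exists_test f hb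
  have hq : Computable₂ fun t k : ℕ => !(Code.evaln k (Denumerable.ofNat Code d) t).isSome :=
    Primrec.not.to_comp.comp
      (computable_evaln_isSome Computable.snd (Computable.const d) Computable.fst)
  obtain ⟨t, ht⟩ := exists_fixed_union hs hq
  by_cases hdt : (app d t).Dom
  · have hex := app_dom_iff_evaln.1 hdt
    -- `j` is the last stage before the test succeeds, hence the last member of the chain admitted
    -- into `t`.
    obtain ⟨j, hj⟩ : ∃ j, Nat.find hex = j + 1 := Nat.exists_eq_succ_of_ne_zero fun h0 => by
      have := Nat.find_spec hex
      rw [h0] at this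
      simp [Code.evaln] at this
    have hrel : S.toPER.rel (s j) t := by
      refine rel_of_dom_iff (h j).dom fun c hc => ⟨fun hjc => ?_, fun htc => ?_⟩
      · exact (ht c).2 ⟨j, by simpa using Nat.find_min hex (m := j) (by omega), hjc⟩
      · obtain ⟨k, hk, hk'⟩ := (ht c).1 htc
        refine le_of_chain hle (not_lt.1 fun hjk => ?_) c hc hk'
        obtain ⟨y, hy⟩ := Option.isSome_iff_exists.1 (Nat.find_spec hex)
        have := Code.evaln_mono (by omega : Nat.find hex ≤ k) hy
        rw [Option.mem_def] at this
        simp [this] at hk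
    exact hno ⟨j, (hd _ _ ((h j).congr hrel (h j).cod)).1 hdt⟩
  · have hrel : S.toPER.rel n t := by
      refine rel_of_dom_iff hdom fun c hc => ?_
      rw [hn c hc, ht c]
      refine exists_congr fun k => (and_iff_right ?_).symm
      rw [Bool.not_eq_true', Bool.eq_false_iff]
      exact fun hk => hdt (app_dom_iff_evaln.2 ⟨k, hk⟩)
    exact hdt ((hd _ _ (hv.congr hrel hv.cod)).2 hvb)

/-- A computable endofunction of a pointed complete extensional PER has a fixed point, the
supremum of its iterates at the least element. -/
theorem exists_fixedPoint (S : PCEPER) {ψ : ℕ → ℕ} (hψ : Computable ψ)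
    (h : ∀ n m, S.toPER.rel n m → S.toPER.rel (ψ n) (ψ m)) :
    ∃ (n : ℕ) (s : ℕ → ℕ), S.toPER.rel (ψ n) n ∧ S.IsSup s n ∧ Computable s ∧
      (∀ k, S.le (s k) (s (k + 1))) ∧ (∀ k, S.toPER.rel (s k) (s k)) ∧ IsBot (s 0) ∧
      ∀ k, s (k + 1) = ψ (s k) := by
  obtain ⟨z, hz⟩ := exists_isBot
  let s : ℕ → ℕ := fun k => Nat.rec z (fun _ y => ψ y) k
  have hs : Computable s := Computable.nat_rec Computable.id (Computable.const z)
    (hψ.comp (Computable.snd.comp Computable.snd)).to₂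
  obtain ⟨n, hn⟩ := exists_union hs
  obtain ⟨f, hf⟩ := exists_hom_of_computable (R := S.toPER) (S := S.toPER) hψ h
  have hd : ∀ k, S.toPER.rel (s k) (s k) := fun k => by
    induction k with
    | zero => exact S.pointed z hz
    | succ k ih => exact h _ _ ih
  have hle : ∀ k, S.le (s k) (s (k + 1)) := fun k => by
    induction k with
    | zero => exact fun b _ hb => absurd hb (hz b)
    | succ k ih => exact (hf _ (hd k)).le (hf _ (hd (k + 1))) ih
  have hsup : S.IsSup s n := fun b _ => hn b
  -- The shifted chain has the same union, so continuity sends `n` to itself.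
  have hsup' : S.IsSup (fun k => s (k + 1)) n := fun b hb => by
    rw [hsup b hb]
    exact ⟨fun ⟨k, hk⟩ => ⟨k, hle k b hb hk⟩, fun ⟨k, hk⟩ => ⟨k + 1, hk⟩⟩
  have hfix := Maps.isSup hs hle (fun k => hf _ (hd k)) hsup hsup'
  exact ⟨n, s, (hf n hfix.dom).rel hfix hfix.dom, hsup, hs, hle, hd, hz, fun _ => rfl⟩

/-! ### Families of elements of pointed complete extensional PERs -/

theorem isBot_cur (h : IsBot n) (a : ℕ) : IsBot (cur n a) := fun b => by
  rw [app_cur]; exact h _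

section Fam

variable {ι : Type} (D : ι → PCEPER) (I : ι → ℕ → Prop) (Q : ℕ → Prop)

/-- Numbers that code a family of elements of `D j`, indexed by the `a` with `I j a`, and that
satisfy the condition `Q`. -/
def famPER : PER where
  rel g g' := Q g ∧ Q g' ∧ ∀ j a, I j a → (D j).toPER.rel (cur g a) (cur g' a)
  symm h := ⟨h.2.1, h.1, fun j a ha => (D j).toPER.symm (h.2.2 j a ha)⟩
  trans h h' := ⟨h.1, h'.2.1, fun j a ha => (D j).toPER.trans (h.2.2 j a ha) (h'.2.2 j a ha)⟩

/-- The base of a PER of families. -/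
def famBase : Set ℕ := {c | ∃ j a b, I j a ∧ b ∈ (D j).base ∧ c = Nat.pair a b}

variable {D I Q}

theorem famBase_forall {P : ℕ → Prop} : (∀ c ∈ famBase D I, P c) ↔
    ∀ j a, I j a → ∀ b ∈ (D j).base, P (Nat.pair a b) := by
  constructor
  · exact fun h j a ha b hb => h _ ⟨j, a, b, ha, hb, rfl⟩
  · rintro h _ ⟨j, a, b, ha, hb, rfl⟩
    exact h j a ha b hb

/-- Over a valid index `a`, the domain of `cur g a` is the slice at `a` of the domain of `g`;
extensionality therefore holds slice by slice, and `hext` carries `Q` along. -/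
theorem famPER_extensional
    (hext : ∀ g g', Q g → (∀ j a, I j a → (D j).toPER.rel (cur g a) (cur g' a)) → Q g') :
    ExtensionalOver (famBase D I) (famPER D I Q) := by
  refine ⟨fun n m h => famBase_forall.2 fun j a ha b hb => ?_, fun n m h h' => ?_⟩
  · simpa only [app_cur] using dom_iff (h.2.2 j a ha) hb
  · rw [famBase_forall] at h'
    have key : ∀ j a, I j a → (D j).toPER.rel (cur n a) (cur m a) := fun j a ha =>
      rel_of_dom_iff (h.2.2 j a ha) (by simpa only [app_cur] using h' j a ha)
    exact ⟨h.1, hext n m h.1 key, key⟩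

theorem famPER_complete
    (hsup : ∀ s n, Computable s → (∀ k, Q (s k)) →
      (∀ j a, I j a → ∀ k, (D j).toPER.rel (cur (s k) a) (cur (s k) a)) →
      (∀ j a, I j a → ∀ k, (D j).le (cur (s k) a) (cur (s (k + 1)) a)) →
      (∀ j a, I j a → (D j).IsSup (fun k => cur (s k) a) (cur n a)) → Q n) :
    CompleteOver (famBase D I) (famPER D I Q) := by
  intro s hs hd hle n hn
  have hle' : ∀ j a, I j a → ∀ k, (D j).le (cur (s k) a) (cur (s (k + 1)) a) :=
    fun j a ha k b hb => by
      simpa only [app_cur] using famBase_forall.1 (hle k) j a ha b hb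
  have hn' : ∀ j a, I j a → (D j).IsSup (fun k => cur (s k) a) (cur n a) :=
    fun j a ha b hb => by
      simpa only [app_cur] using famBase_forall.1 hn j a ha b hb
  have hQ : Q n := hsup s n hs (fun k => (hd k).1) (fun j a ha k => (hd k).2.2 j a ha) hle' hn'
  exact ⟨hQ, hQ, fun j a ha => (hn' j a ha).dom (computable₂_cur.comp hs (Computable.const a))
    (fun k => (hd k).2.2 j a ha) (hle' j a ha)⟩

end Fam

/-! ### Limits of diagrams with indices -/

theorem strict_iff {S T : PCEPER} {f : S.toPER ⟶ T.toPER} :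
    Strict f ↔ ∀ n m, IsBot n → IsBot m → Maps f n m :=
  ⟨fun h n m hn hm => ⟨S.pointed n hn, T.pointed m hm, h n m hn hm⟩,
    fun h n m hn hm => (h n m hn hm).2.2⟩

theorem strict_of_maps {S T : PCEPER} {f : S.toPER ⟶ T.toPER}
    (h : ∀ n, IsBot n → ∃ m, IsBot m ∧ Maps f n m) : Strict f := by
  refine strict_iff.2 fun n m hn hm => ?_
  obtain ⟨k, hk, h⟩ := h n hn
  exact h.congr h.dom (rel_of_isBot hk hm)

section Lim

variable {J : Type} [Category.{0} J] {D : J ⥤ PCEPER} {I : J → ℕ → Prop}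

variable (D I) in
/-- Families of elements that are compatible with all morphisms of a diagram. -/
def Compatible (g : ℕ) : Prop :=
  ∀ (i j : J) (m : i ⟶ j) (a b : ℕ), I i a → I j b → Maps (D.map m).hom (cur g a) (cur g b)

theorem Compatible.rel {g : ℕ} (h : Compatible D I g) {j : J} {a b : ℕ} (ha : I j a)
    (hb : I j b) : (D.obj j).toPER.rel (cur g a) (cur g b) := by
  have h1 := h j j (𝟙 j) a b ha hb
  rw [D.map_id] at h1
  exact (Maps.id h1.dom).rel h1 h1.dom

variable (D I) in
/-- The PER of compatible families of a diagram. -/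
def lim : PCEPER where
  toPER := famPER D.obj I (Compatible D I)
  exists_base := by
    refine ⟨famBase D.obj I, famPER_extensional fun g g' hg h i j m a b ha hb => ?_,
      famPER_complete fun s n hs hQ hd hle hn i j m a b ha hb => ?_⟩
    · exact (hg i j m a b ha hb).congr (h i a ha) (h j b hb)
    · exact Maps.isSup (computable₂_cur.comp hs (Computable.const a)) (hle i a ha)
        (fun k => hQ k i j m a b ha hb) (hn i a ha) (hn j b hb)
  pointed n hn := by
    -- Strictness of the diagram's morphisms is what makes the nowhere defined family compatible.
    have h : Compatible D I n := fun i j m a b _ _ =>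
      strict_iff.1 (D.map m).strict _ _ (isBot_cur hn a) (isBot_cur hn b)
    exact ⟨h, h, fun j a _ => (D.obj j).pointed _ (isBot_cur hn a)⟩

theorem exists_limProj (hI : ∀ j, ∃ a, I j a) (j : J) :
    ∃ π : lim D I ⟶ D.obj j, ∀ g a, (lim D I).toPER.rel g g → I j a →
      Maps π.hom g (cur g a) := by
  obtain ⟨a, ha⟩ := hI j
  obtain ⟨π, hπ⟩ := exists_hom_of_computable (R := (lim D I).toPER) (S := (D.obj j).toPER)
    (computable₂_cur.comp Computable.id (Computable.const a)) fun n m h => h.2.2 j a ha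
  refine ⟨⟨π, strict_of_maps fun n hn =>
    ⟨_, isBot_cur hn a, hπ n ((lim D I).pointed n hn)⟩⟩, fun g b hg hb => ?_⟩
  exact (hπ g hg).congr hg (hg.1.rel ha hb)

/-- The projections of the limit. -/
noncomputable def limProj (D : J ⥤ PCEPER) (hI : ∀ j, ∃ a, I j a) (j : J) :
    lim D I ⟶ D.obj j := (exists_limProj hI j).choose

variable {hI : ∀ j, ∃ a, I j a}

theorem maps_limProj {j : J} {g a : ℕ} (hg : (lim D I).toPER.rel g g) (ha : I j a) :
    Maps (limProj D hI j).hom g (cur g a) := (exists_limProj hI j).choose_spec g a hg ha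

theorem hom_ext {S T : PCEPER} {f g : S ⟶ T} (h : f.hom = g.hom) : f = g := Hom.ext h

theorem limProj_comp {i j : J} (m : i ⟶ j) : limProj D hI i ≫ D.map m = limProj D hI j := by
  obtain ⟨a, ha⟩ := hI i
  obtain ⟨b, hb⟩ := hI j
  refine hom_ext (Maps.hom_ext fun g hg => ⟨cur g b, ?_, maps_limProj hg hb⟩)
  exact (maps_limProj hg ha).comp (hg.1 i j m a b ha hb)

theorem lim_joint_mono_hom {X : PER} {u v : X ⟶ (lim D I).toPER}
    (h : ∀ j, u ≫ (limProj D hI j).hom = v ≫ (limProj D hI j).hom) : u = v := by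
  refine Maps.hom_ext fun n hn => ?_
  obtain ⟨g, hg⟩ := Maps.exists_of_dom u hn
  obtain ⟨g', hg'⟩ := Maps.exists_of_dom v hn
  refine ⟨g', hg.congr hn ⟨hg.cod.1, hg'.cod.1, fun j a ha => ?_⟩, hg'⟩
  have h1 := hg.comp (maps_limProj (hI := hI) hg.cod ha)
  rw [h] at h1
  exact h1.rel (hg'.comp (maps_limProj hg'.cod ha)) hn

theorem lim_joint_mono {X : PCEPER} {u v : X ⟶ lim D I}
    (h : ∀ j, u ≫ limProj D hI j = v ≫ limProj D hI j) : u = v :=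
  hom_ext (lim_joint_mono_hom fun j => congrArg Hom.hom (h j))

/-- A uniformly tracked cone factors through the limit. -/
theorem exists_lift {X : PER} (h : ∀ j, X ⟶ (D.obj j).toPER)
    (hcomp : ∀ {i j} (m : i ⟶ j), h i ≫ (D.map m).hom = h j) {ψ : ℕ → ℕ} (hψ : Computable ψ)
    (htr : ∀ n, X.rel n n → ∀ j a, I j a → Maps (h j) n (cur (ψ n) a)) :
    ∃ u : X ⟶ (lim D I).toPER, ∀ j, u ≫ (limProj D hI j).hom = h j := by
  have hc : ∀ n, X.rel n n → Compatible D I (ψ n) := fun n hn i j m a b ha hb =>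
    Maps.of_comp (by rw [hcomp]; exact htr n hn j b hb) (htr n hn i a ha)
  obtain ⟨u, hu⟩ := exists_hom_of_computable (R := X) (S := (lim D I).toPER) hψ fun n m hnm =>
    ⟨hc n (left hnm), hc m (right hnm), fun j a ha =>
      (htr n (left hnm) j a ha).rel (htr m (right hnm) j a ha) hnm⟩
  refine ⟨u, fun j => Maps.hom_ext fun n hn => ?_⟩
  obtain ⟨a, ha⟩ := hI j
  exact ⟨_, (hu n hn).comp (maps_limProj (hu n hn).cod ha), htr n hn j a ha⟩

/-- Least elements of the limit are least in each component, and the relation on families is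
componentwise. -/
theorem strict_of_comp_limProj {X : PCEPER} {u : X.toPER ⟶ (lim D I).toPER}
    (h : ∀ j, Strict (u ≫ (limProj D hI j).hom)) : Strict u := by
  refine strict_iff.2 fun n m hn hm => ?_
  obtain ⟨g, hg⟩ := Maps.exists_of_dom u (X.pointed n hn)
  refine hg.congr hg.dom ⟨hg.cod.1, ((lim D I).pointed m hm).1, fun j a ha => ?_⟩
  exact (hg.comp (maps_limProj hg.cod ha)).rel
    (strict_iff.1 (h j) n _ hn (isBot_cur hm a)) hg.dom

end Lim

/-! ### The reflection -/

section Reflection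

variable (R : PER)

/-- The indices of an object under `R` are those of its structure morphism. -/
def arrowIndex (j : StructuredArrow R incl) (a : ℕ) : Prop :=
  Tracks (R := R) (S := j.right.toPER) a j.hom

theorem exists_arrowIndex (j : StructuredArrow R incl) : ∃ a, arrowIndex R j a :=
  exists_tracks (R := R) (S := j.right.toPER) j.hom

/-- The reflection of a PER, a limit over all morphisms to pointed complete extensional PERs. -/
abbrev reflection : PCEPER := lim (StructuredArrow.proj R incl) (arrowIndex R)

/-- The projections of the reflection. -/
noncomputable abbrev reflProj (j : StructuredArrow R incl) : reflection R ⟶ j.right :=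
  limProj (StructuredArrow.proj R incl) (exists_arrowIndex R) j

theorem reflProj_comp {i j : StructuredArrow R incl} (m : i ⟶ j) :
    reflProj R i ≫ m.right = reflProj R j :=
  limProj_comp (D := StructuredArrow.proj R incl) (hI := exists_arrowIndex R) m

/-- The unit sends `n` to the family `a ↦ a n`, where `a` runs over the indices of morphisms out of
`R`. -/
theorem exists_unit : ∃ η : R ⟶ incl.obj (reflection R), ∀ j, η ≫ incl.map (reflProj R j) = j.hom := by
  obtain ⟨ψ, hψ, h⟩ := exists_smn_cur (ψ := fun n p => (app p.1 n).bind fun y => app y p.2)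
    (Partrec.bind (partrec₂_app.comp (Computable.fst.comp Computable.snd) Computable.fst)
      (partrec₂_app.comp Computable.snd
        (Computable.snd.comp (Computable.snd.comp Computable.fst))))
  refine exists_lift (D := StructuredArrow.proj R incl) (hI := exists_arrowIndex R) (fun j => j.hom)
    (fun m => StructuredArrow.w m) hψ fun n hn j a ha => ?_
  obtain ⟨y, hy, h1⟩ := ha.exists_maps hn
  refine h1.congr hn (rel_of_app_eq h1.cod fun b => ?_)
  rw [h, Part.eq_some_iff.2 hy, Part.bind_some]

/-- The unit is initial among arrows from `R`: the projections are arrows under `R`, and the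
projection at the unit itself is the identity, which forces uniqueness. -/
theorem isRightAdjoint_incl : incl.IsRightAdjoint := by
  refine isRightAdjoint_iff_hasInitial_structuredArrow.2 fun R => ?_
  obtain ⟨η, hη⟩ := exists_unit R
  let m : ∀ j, StructuredArrow.mk η ⟶ j := fun j => StructuredArrow.homMk (reflProj R j) (hη j)
  have hself : reflProj R (StructuredArrow.mk η) = 𝟙 (reflection R) :=
    lim_joint_mono (D := StructuredArrow.proj R incl) (hI := exists_arrowIndex R) fun j =>
      (reflProj_comp R (m j)).trans (Category.id_comp _).symm
  refine (IsInitial.ofUniqueHom m fun j u => ?_).hasInitial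
  ext1
  have := reflProj_comp R u
  rw [hself] at this
  exact (Category.id_comp _).symm.trans this

end Reflection

/-! ### Initial algebras -/

section InitialAlgebra

variable (F : PCEPER ⥤ PCEPER)

/-- The indices of an algebra are those of its structure morphism. -/
def algIndex (A : Algebra F) (a : ℕ) : Prop := Tracks a A.str.hom

theorem exists_algIndex (A : Algebra F) : ∃ a, algIndex F A a := exists_tracks A.str.hom

/-- The carrier of the initial algebra, a limit over all algebras. -/
abbrev mu : PCEPER := lim (Algebra.forget F) (algIndex F)

/-- The projections to the carriers of algebras. -/
noncomputable abbrev muProj (A : Algebra F) : mu F ⟶ A.a :=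
  limProj (Algebra.forget F) (exists_algIndex F) A

variable {F}

theorem muProj_comp {A B : Algebra F} (m : A ⟶ B) : muProj F A ≫ m.f = muProj F B :=
  limProj_comp (D := Algebra.forget F) (hI := exists_algIndex F) m

theorem mu_joint_mono {X : PCEPER} {u v : X ⟶ mu F}
    (h : ∀ A, u ≫ muProj F A = v ≫ muProj F A) : u = v :=
  lim_joint_mono (D := Algebra.forget F) (hI := exists_algIndex F) h

/-- As for `R0`, but the components are r.e. sets, so the family is coded by its elements;
strictness is checked on the projections. -/
theorem exists_mu_str {φ : ℕ →. ℕ} (hφ : Nat.Partrec φ) (hF : TracksFunctor incl incl F φ) :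
    ∃ γ : F.obj (mu F) ⟶ mu F, ∀ A, γ ≫ muProj F A = F.map (muProj F A) ≫ A.str := by
  obtain ⟨p, hp, hp'⟩ := exists_smn (ψ := fun a g => Part.some (cur g a))
    (computable₂_cur.comp Computable.snd Computable.fst)
  have hpt : ∀ (A : Algebra F) a, Tracks a A.str.hom → Tracks (p a) (muProj F A).hom :=
    fun A a ha => tracks_iff.2 fun g hg =>
      ⟨cur g a, by rw [hp']; exact Part.mem_some _,
        maps_limProj (D := Algebra.forget F) (hI := exists_algIndex F) hg ha⟩
  obtain ⟨ψ, hψ, h⟩ := exists_smn_cur (ψ := fun n q => (φ (p q.1)).bind fun y =>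
      (app y n).bind fun z => (app q.1 z).bind fun w => app w q.2) (by
    refine Partrec.bind ((Partrec.nat_iff.2 hφ).comp
      (hp.comp (Computable.fst.comp Computable.snd))) ?_
    refine Partrec.bind (partrec₂_app.comp Computable.snd
      (Computable.fst.comp Computable.fst)) ?_
    refine Partrec.bind (partrec₂_app.comp (Computable.fst.comp (Computable.snd.comp
      (Computable.fst.comp Computable.fst))) Computable.snd) ?_
    exact partrec₂_app.comp Computable.snd (Computable.snd.comp (Computable.snd.comp
      (Computable.fst.comp (Computable.fst.comp Computable.fst)))))
  obtain ⟨u, hu⟩ := exists_lift (D := Algebra.forget F) (hI := exists_algIndex F)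
    (X := (F.obj (mu F)).toPER) (fun A => (F.map (muProj F A) ≫ A.str).hom) (fun {A B} m => by
      change ((F.map (muProj F A) ≫ A.str) ≫ m.f).hom = _
      rw [Category.assoc, ← m.h, ← Category.assoc, ← F.map_comp, muProj_comp]) hψ
    (fun n hn A a ha => by
      obtain ⟨y, hy, hyt⟩ := hF _ _ (muProj F A) (p a) (hpt A a ha)
      obtain ⟨z, hz, h1⟩ := hyt.exists_maps hn
      obtain ⟨w, hw, h2⟩ := ha.exists_maps h1.cod
      refine (h1.comp h2).congr hn (rel_of_app_eq h2.cod fun b => ?_)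
      rw [h, Part.eq_some_iff.2 hy, Part.bind_some, Part.eq_some_iff.2 hz, Part.bind_some,
        Part.eq_some_iff.2 hw, Part.bind_some])
  refine ⟨⟨u, strict_of_comp_limProj (D := Algebra.forget F) (hI := exists_algIndex F)
    fun A => ?_⟩, fun A => hom_ext (hu A)⟩
  rw [hu]
  exact (F.map (muProj F A) ≫ A.str).strict

theorem exists_initialAlgebra (hF : Realizable incl F) :
    ∃ A : Algebra F, Nonempty (IsInitial A) := by
  obtain ⟨φ, hφ, hF⟩ := hF
  obtain ⟨γ, hγ⟩ := exists_mu_str hφ hF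
  let m : ∀ A, (⟨mu F, γ⟩ : Algebra F) ⟶ A := fun A => ⟨muProj F A, (hγ A).symm⟩
  have hself : muProj F ⟨mu F, γ⟩ = 𝟙 (mu F) := mu_joint_mono fun A => by
    rw [Category.id_comp]
    exact muProj_comp (m A)
  refine ⟨_, ⟨IsInitial.ofUniqueHom m fun A u => ?_⟩⟩
  ext1
  have := muProj_comp u
  rw [hself, Category.id_comp] at this
  exact this

end InitialAlgebra

/-! ### The object of strict morphisms -/

section HomObj

variable {R S : PCEPER} {g g' : ℕ} {f f' : R ⟶ S}

/-- `g` codes a strict morphism from `R` to `S`. -/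
def StrictCode (R S : PCEPER) (g : ℕ) : Prop :=
  (∀ r r', R.toPER.rel r r' → S.toPER.rel (cur g r) (cur g r')) ∧
    ∀ z, IsBot z → S.toPER.rel (cur g z) z

/-- The pointed complete extensional PER of codes of strict morphisms. -/
def homObj (R S : PCEPER) : PCEPER where
  toPER := famPER (fun _ : Unit => S) (fun _ r => R.toPER.rel r r) (StrictCode R S)
  exists_base := by
    refine ⟨famBase (fun _ : Unit => S) (fun _ r => R.toPER.rel r r),
      famPER_extensional fun g g' hg h => ⟨fun r r' hr => ?_, fun z hz => ?_⟩,
      famPER_complete fun s n hs hQ hd hle hn => ⟨fun r r' hr => ?_, fun z hz => ?_⟩⟩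
    · exact S.toPER.trans (S.toPER.symm (h () r (left hr)))
        (S.toPER.trans (hg.1 r r' hr) (h () r' (right hr)))
    · exact S.toPER.trans (S.toPER.symm (h () z (R.pointed z hz))) (hg.2 z hz)
    · refine rel_of_dom_iff ((hn () r (left hr)).dom (computable₂_cur.comp hs
        (Computable.const r)) (hd () r (left hr)) (hle () r (left hr))) fun b hb => ?_
      rw [hn () r (left hr) b hb, hn () r' (right hr) b hb]
      exact exists_congr fun k => dom_iff ((hQ k).1 r r' hr) hb
    · refine S.toPER.symm (rel_of_dom_iff (S.pointed z hz) fun b hb => iff_of_false (hz b) ?_)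
      rw [hn () z (R.pointed z hz) b hb]
      rintro ⟨k, hk⟩
      exact hz b ((dom_iff ((hQ k).2 z hz) hb).1 hk)
  pointed n hn := by
    have h : StrictCode R S n := ⟨fun r r' _ => rel_of_isBot (isBot_cur hn r) (isBot_cur hn r'),
      fun z hz => rel_of_isBot (isBot_cur hn z) hz⟩
    exact ⟨h, h, fun _ r _ => S.pointed _ (isBot_cur hn r)⟩

/-- `g` is a code of the morphism `f`. -/
def Codes (g : ℕ) (f : R ⟶ S) : Prop := ∀ r, R.toPER.rel r r → Maps f.hom r (cur g r)

theorem Codes.strictCode (h : Codes g f) : StrictCode R S g :=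
  ⟨fun r r' hr => (h r (left hr)).rel (h r' (right hr)) hr, fun z hz =>
    (h z (R.pointed z hz)).rel (strict_iff.1 f.strict z z hz hz) (R.pointed z hz)⟩

theorem Codes.rel (h : Codes g f) (h' : Codes g' f) : (homObj R S).toPER.rel g g' :=
  ⟨h.strictCode, h'.strictCode, fun _ r hr => (h r hr).rel (h' r hr) hr⟩

theorem Codes.congr (h : Codes g f) (hg : (homObj R S).toPER.rel g g') : Codes g' f :=
  fun r hr => (h r hr).congr hr (hg.2.2 () r hr)

theorem Codes.unique (h : Codes g f) (h' : Codes g f') : f = f' :=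
  hom_ext (Maps.hom_ext fun r hr => ⟨_, h r hr, h' r hr⟩)

theorem exists_codes_of_rel (h : (homObj R S).toPER.rel g g) : ∃ f : R ⟶ S, Codes g f := by
  obtain ⟨f, hf⟩ := exists_hom_of_computable (R := R.toPER) (S := S.toPER)
    (computable₂_cur.comp (Computable.const g) Computable.id) h.1.1
  exact ⟨⟨f, strict_of_maps fun z hz => ⟨z, hz, (hf z (R.pointed z hz)).congr
    (R.pointed z hz) (h.1.2 z hz)⟩⟩, hf⟩

end HomObj

/-! ### Fixed points of `f ↦ u ≫ F f ≫ v` and algebraic compactness -/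

section LeastFixedPoint

variable {F : PCEPER ⥤ PCEPER} {φ : ℕ →. ℕ}

/-- A code of `f` yields an index of `f`, to which `φ` applies; realizability thus makes the
operator computable on codes. -/
theorem exists_operator (hφ : Nat.Partrec φ) (hF : TracksFunctor incl incl F φ)
    {R S X Y : PCEPER} (u : X ⟶ F.obj R) (v : F.obj S ⟶ Y) :
    ∃ ψ : ℕ → ℕ, Computable ψ ∧ ∀ g (f : R ⟶ S), Codes g f →
      Codes (ψ g) (u ≫ F.map f ≫ v) := by
  obtain ⟨p, hp, hp'⟩ := exists_smn (ψ := fun g r => Part.some (cur g r)) computable₂_cur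
  obtain ⟨x, hx⟩ := exists_tracks u.hom
  obtain ⟨y, hy⟩ := exists_tracks v.hom
  obtain ⟨ψ, hψ, h⟩ := exists_smn_cur (ψ := fun g q => (φ (p g)).bind fun c =>
      (app x q.1).bind fun k => (app c k).bind fun l => (app y l).bind fun w => app w q.2) (by
    refine Partrec.bind ((Partrec.nat_iff.2 hφ).comp (hp.comp Computable.fst)) ?_
    refine Partrec.bind (partrec₂_app.comp (Computable.const x)
      (Computable.fst.comp (Computable.snd.comp Computable.fst))) ?_
    refine Partrec.bind (partrec₂_app.comp (Computable.snd.comp Computable.fst)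
      Computable.snd) ?_
    refine Partrec.bind (partrec₂_app.comp (Computable.const y) Computable.snd) ?_
    exact partrec₂_app.comp Computable.snd (Computable.snd.comp (Computable.snd.comp
      (Computable.fst.comp (Computable.fst.comp (Computable.fst.comp Computable.fst))))))
  refine ⟨ψ, hψ, fun g f hg r hr => ?_⟩
  obtain ⟨c, hc, hct⟩ := hF _ _ f (p g) (tracks_iff.2 fun n hn =>
    ⟨cur g n, by rw [hp']; exact Part.mem_some _, hg n hn⟩)
  obtain ⟨k, hk, h1⟩ := hx.exists_maps hr
  obtain ⟨l, hl, h2⟩ := hct.exists_maps h1.cod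
  obtain ⟨w, hw, h3⟩ := hy.exists_maps h2.cod
  refine (h1.comp (h2.comp h3)).congr hr (rel_of_app_eq h3.cod fun b => ?_)
  rw [h, Part.eq_some_iff.2 hc, Part.bind_some, Part.eq_some_iff.2 hk, Part.bind_some,
    Part.eq_some_iff.2 hl, Part.bind_some, Part.eq_some_iff.2 hw, Part.bind_some]

/-- The operator `f ↦ u ≫ F f ≫ v` has a fixed point that is determined by its finite
approximations. -/
theorem exists_leastFixedPoint (hφ : Nat.Partrec φ) (hF : TracksFunctor incl incl F φ)
    {S T : PCEPER} (u : S ⟶ F.obj S) (v : F.obj T ⟶ T) :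
    ∃ (f : S ⟶ T) (a : ℕ → (S ⟶ T)), u ≫ F.map f ≫ v = f ∧
      (∀ k, a (k + 1) = u ≫ F.map (a k) ≫ v) ∧
      (∀ (X : PCEPER) (g g' : X ⟶ S), g ≫ a 0 = g' ≫ a 0) ∧
      ∀ (X : PCEPER) (g g' : X ⟶ S), (∀ k, g ≫ a k = g' ≫ a k) → g ≫ f = g' ≫ f := by
  obtain ⟨ψ, hψ, hcode⟩ := exists_operator hφ hF u v
  obtain ⟨n, s, hfix, hsup, hs, hle, hd, h0, hsucc⟩ := exists_fixedPoint (homObj S T) hψ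
    fun g g' h => by
      obtain ⟨f, hf⟩ := exists_codes_of_rel (left h)
      exact (hcode g f hf).rel (hcode g' f (hf.congr h))
  have hn := hsup.dom hs hd hle
  obtain ⟨f, hf⟩ := exists_codes_of_rel hn
  choose a ha using fun k => exists_codes_of_rel (hd k)
  refine ⟨f, a, ((hcode n f hf).congr hfix).unique hf, fun k => (ha (k + 1)).unique ?_,
    fun X g g' => ?_, fun X g g' h => ?_⟩
  · rw [hsucc]
    exact hcode _ _ (ha k)
  -- The code `s 0` is nowhere defined, so `a 0` is constantly the least element.
  · refine hom_ext (Maps.hom_ext fun x hx => ?_)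
    obtain ⟨r, hr⟩ := Maps.exists_of_dom g.hom hx
    obtain ⟨r', hr'⟩ := Maps.exists_of_dom g'.hom hx
    exact ⟨_, (hr.comp (ha 0 r hr.cod)).congr hx
      (rel_of_isBot (isBot_cur h0 r) (isBot_cur h0 r')), hr'.comp (ha 0 r' hr'.cod)⟩
  · refine hom_ext (Maps.hom_ext fun x hx => ?_)
    obtain ⟨r, hr⟩ := Maps.exists_of_dom g.hom hx
    obtain ⟨r', hr'⟩ := Maps.exists_of_dom g'.hom hx
    obtain ⟨m, hm⟩ := exists_union (computable₂_cur.comp hs (Computable.const r))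
    have hm' : T.IsSup (fun k => cur (s k) r) m := fun b _ => hm b
    -- Evaluation at `q` is a morphism out of `homObj S T`, hence continuous: `f` at `q` is the
    -- union of the approximations there, which agree with those at `r`.
    have key : ∀ q, S.toPER.rel q q → (∀ k, T.toPER.rel (cur (s k) q) (cur (s k) r)) →
        Maps f.hom q m := fun q hq hqr => by
      obtain ⟨e, he⟩ := exists_hom_of_computable (R := (homObj S T).toPER) (S := T.toPER)
        (computable₂_cur.comp Computable.id (Computable.const q)) fun g g' h => h.2.2 () q hq
      have h1 := Maps.isSup hs hle
        (fun k => (he _ (hd k)).congr (hd k) (hqr k)) hsup hm'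
      exact (hf q hq).congr hq ((he n hn).rel h1 hn)
    refine ⟨m, hr.comp (key r hr.cod fun k => (hd k).2.2 () r hr.cod),
      hr'.comp (key r' hr'.cod fun k => ?_)⟩
    have h1 := hr.comp (ha k r hr.cod)
    have h2 := hr'.comp (ha k r' hr'.cod)
    have h3 : g.hom ≫ (a k).hom = g'.hom ≫ (a k).hom := congrArg Hom.hom (h k)
    rw [h3] at h1
    exact h2.rel h1 hx

theorem algebraicallyCompact : AlgebraicallyCompact (Realizable incl) := by
  intro F hF
  obtain ⟨A, ⟨hA⟩⟩ := exists_initialAlgebra hF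
  obtain ⟨φ, hφ, hF⟩ := hF
  have := Algebra.Initial.str_isIso hA
  obtain ⟨p, a, hp, ha, h0, hmono⟩ := exists_leastFixedPoint hφ hF (inv A.str) A.str
  -- The fixed point equation says that `p` is an algebra endomorphism of the initial algebra.
  have hp1 : p = 𝟙 A.a := by
    let m : A ⟶ A := ⟨p, by rw [IsIso.inv_comp_eq] at hp; exact hp⟩
    exact congrArg Algebra.Hom.f (hA.hom_ext m (𝟙 A))
  choose f _ hf _ using fun V : Coalgebra F => exists_leastFixedPoint hφ hF V.str A.str
  have hfV : ∀ V, V.str ≫ F.map (f V) = f V ≫ inv A.str := fun V => by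
    rw [IsIso.eq_comp_inv, Category.assoc, hf]
  refine ⟨A, ⟨hA⟩, asIso A.str, rfl, ⟨IsTerminal.ofUniqueHom (fun V => ⟨f V, hfV V⟩)
    fun V h => ?_⟩⟩
  ext1
  -- For a coalgebra morphism `g`, the composite with an iterate depends only on the composite with
  -- the previous one; by induction all coalgebra morphisms agree on the iterates.
  have key : ∀ (k : ℕ) (g : V.V ⟶ A.a), V.str ≫ F.map g = g ≫ inv A.str →
      g ≫ a (k + 1) = V.str ≫ F.map (g ≫ a k) ≫ A.str := fun k g hg => by
    rw [ha, ← Category.assoc, ← hg, F.map_comp, Category.assoc, Category.assoc]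
  have := hmono _ h.f (f V) fun k => by
    induction k with
    | zero => exact h0 _ _ _
    | succ k ih => rw [key k h.f h.h, key k (f V) (hfV V), ih]
  rwa [hp1, Category.comp_id, Category.comp_id] at this

theorem algebraicallyComplete : AlgebraicallyComplete (Realizable incl) :=
  fun _ => exists_initialAlgebra

end LeastFixedPoint

end PCEPER

end Realizability

open Realizability PER in
theorem mainTheorem3 :
    AlgebraicallyComplete (Realizable (𝟭 PER)) ∧
    (∀ (F : PER ⥤ PER) (φ : ℕ →. ℕ), Nat.Partrec φ → TracksFunctor (𝟭 PER) (𝟭 PER) F φ →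
      (∀ f f' : ℕ, (R0 F).rel f f' ↔
        (∀ R : PER, (exp (exp (F.obj R) R) R).rel f f') ∧ CommutesWithAlgHoms F f) ∧
      ∃ γ : F.obj (R0 F) ⟶ R0 F,
        (∃ (p : ℕ → ℕ) (c : ℕ), IsEvalIndex p ∧ IsAlgIndex φ p c) ∧
        (∀ (p : ℕ → ℕ) (c : ℕ), IsEvalIndex p → IsAlgIndex φ p c → Tracks c γ) ∧
        Nonempty (IsInitial ({ a := R0 F, str := γ } : Algebra F)) ∧
        ∃ π : (Functor.const (Algebra F)).obj (R0 F) ⟶ Algebra.forget F,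
          (∀ p : ℕ → ℕ, IsEvalIndex p → ∀ (A : Algebra F) (a : ℕ), Tracks a A.str →
            Tracks (R := R0 F) (S := A.a) (p a) (π.app A)) ∧
          (∀ A : Algebra F, γ ≫ π.app A = F.map (π.app A) ≫ A.str) ∧
          Nonempty (IsLimit ({ pt := R0 F, π := π } : Cone (Algebra.forget F)))) ∧
    PCEPER.incl.IsRightAdjoint ∧
    AlgebraicallyComplete (Realizable PCEPER.incl) ∧
    AlgebraicallyCompact (Realizable PCEPER.incl) := by
  exact ⟨algebraicallyComplete_PER,
    fun F φ hφ hF => ⟨fun _ _ => R0_rel_iff_exp, initialAlgebra_PER F φ hφ hF⟩,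
    PCEPER.isRightAdjoint_incl, PCEPER.algebraicallyComplete, PCEPER.algebraicallyCompact⟩
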